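/- For an $m\times r$ integer matrix $M$, let $H\le\mathbb{Z}^m$ be the subgroup generated by the columns of $M$, and let $e_1,\dots,e_m$ be the standard basis of $\mathbb{Z}^m$. The standardized abelian Cayley graph of $M$ is the Cayley graph $\mathrm{Cay}(\mathbb{Z}^m/H,\{H\pm e_1,\dots,H\pm e_m\})$: its vertices are the elements of $\mathbb{Z}^m/H$, and $x$, $y$ are adjacent if and only if $y-x=H\pm e_j$ for some $j$ (so it has loops if and only if some $e_j\in H$). A diamond is a complete graph on $4$ vertices with one edge deleted; its endpoints are the two nonadjacent vertices. An unclasped diamond lanyard of length $1$ is a diamond, and an unclasped diamond lanyard of length $\ell+1$ is the union of an unclasped diamond lanyard $Y$ of length $\ell$ and a diamond $D$ such that $Y$ and $D$ have exactly one endpoint in common (other vertices and edges may be shared); its endpoints are the endpoint of $Y$ that is not an endpoint of $D$ and the endpoint of $D$ that is not an endpoint of $Y$. A diamond lanyard is obtained from an unclasped diamond lanyard by adding an edge between its two endpoints. **Lemma.** Let $y_{22},y_{32}\in\mathbb{Z}$, and let $X$ be the standardized abelian Cayley graph of the matrix $$\begin{pmatrix}1&0\\1&y_{22}\\1&y_{32}\end{pmatrix}.$$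 Then $X$ has loops if and only if the set $\{y_{22},y_{32}\}$ is $\{0,-1\}$ or $\{0,1\}$ or $\{-1\}$ or $\{1\}$. Otherwise, $$\chi(X)=\begin{cases}3&\text{if }y_{32}\equiv-y_{22}\pmod 3,\\4&\text{if }y_{32}\not\equiv-y_{22}\pmod 3,\end{cases}$$ and in the second case $X$ contains a diamond lanyard as a (not necessarily induced) subgraph. -/

import Mathlib

namespace SACG

/-- The subgroup `H` of `ℤ^m` of all integer linear combinations of the columns of `M`. -/
def relations {m r : ℕ} (M : Matrix (Fin m) (Fin r) ℤ) : Submodule ℤ (Fin m → ℤ) :=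
  Submodule.span ℤ (Set.range M.col)

/-- The underlying group `ℤ^m / H`, which is the vertex set of the graph. -/
abbrev Vertex {m r : ℕ} (M : Matrix (Fin m) (Fin r) ℤ) : Type :=
  (Fin m → ℤ) ⧸ relations M

/-- The class `H + e_j` of the `j`-th standard basis vector. -/
def gen {m r : ℕ} (M : Matrix (Fin m) (Fin r) ℤ) (j : Fin m) : Vertex M :=
  (relations M).mkQ (Pi.single j 1)

/-- The generating set `S = {H ± e_1, …, H ± e_m}`. -/
def generators {m r : ℕ} (M : Matrix (Fin m) (Fin r) ℤ) : Set (Vertex M) :=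
  {g | ∃ j : Fin m, g = gen M j ∨ g = -gen M j}

/-- The standardized abelian Cayley graph of `M`, that is `Cay(ℤ^m / H, S)`, with its loops if it
has any: `x` and `y` are joined exactly when `y - x ∈ S`. The relation is symmetric, see
`graph_symm`. -/
def graph {m r : ℕ} (M : Matrix (Fin m) (Fin r) ℤ) : Digraph (Vertex M) where
  Adj x y := y - x ∈ generators M

theorem graph_symm {m r : ℕ} (M : Matrix (Fin m) (Fin r) ℤ) {x y : Vertex M}
    (h : (graph M).Adj x y) : (graph M).Adj y x := by
  obtain ⟨j, hj | hj⟩ := h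
  · exact ⟨j, Or.inr (by rw [← hj, neg_sub])⟩
  · exact ⟨j, Or.inl (by rw [← neg_sub, hj, neg_neg])⟩

/-- The graph of `M` has loops. -/
def HasLoops {m r : ℕ} (M : Matrix (Fin m) (Fin r) ℤ) : Prop :=
  ∃ x, (graph M).Adj x x

/-- The standardized abelian Cayley graph as a simple graph. Loops are discarded here, so that this
is the standardized abelian Cayley graph itself exactly when there are none, see
`simpleGraph_adj_iff`. -/
def simpleGraph {m r : ℕ} (M : Matrix (Fin m) (Fin r) ℤ) : SimpleGraph (Vertex M) :=
  SimpleGraph.addCayley (generators M)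

theorem simpleGraph_adj_iff {m r : ℕ} (M : Matrix (Fin m) (Fin r) ℤ) (h : ¬ HasLoops M)
    (x y : Vertex M) : (simpleGraph M).Adj x y ↔ (graph M).Adj x y := by
  have key : ∀ a b : Vertex M, -a + b ∈ generators M ↔ (graph M).Adj a b := by
    intro a b
    rw [neg_add_eq_sub]
    rfl
  rw [simpleGraph, SimpleGraph.addCayley_adj, key, key]
  constructor
  · rintro ⟨-, h1 | h1⟩
    · exact h1
    · exact graph_symm M h1
  · intro h1
    refine ⟨?_, Or.inl h1⟩
    rintro rfl
    exact h ⟨x, h1⟩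

end SACG

namespace DiamondLanyard

/- A finite graph without isolated vertices, drawn on vertices from `V`, is represented here by its
set of edges, as a `SimpleGraph V`; the union of two such graphs is `⊔`, and one is a (not
necessarily induced) subgraph of `G` when it is `≤ G`. -/

/-- `D` is a diamond with endpoints `a` and `b`: the complete graph on four distinct vertices
`a, b, c, d`, with the edge `ab` deleted. -/
def IsDiamond {V : Type*} (D : SimpleGraph V) (a b : V) : Prop :=
  ∃ c d : V, a ≠ b ∧ a ≠ c ∧ a ≠ d ∧ b ≠ c ∧ b ≠ d ∧ c ≠ d ∧
    D = SimpleGraph.fromEdgeSet {s(a, c), s(a, d), s(b, c), s(b, d), s(c, d)}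

/-- `IsUnclasped n U a b`: `U` is an unclasped diamond lanyard of length `n` with endpoints `a` and
`b` (in either order). One of length `n + 1` is the union of one of length `n` and a diamond that
have exactly one endpoint in common; they may share other vertices, and edges. -/
inductive IsUnclasped {V : Type*} : ℕ → SimpleGraph V → V → V → Prop
  | diamond {D : SimpleGraph V} {a b : V} (hD : IsDiamond D a b) : IsUnclasped 1 D a b
  | union {n : ℕ} {Y D : SimpleGraph V} {a b c : V} (hY : IsUnclasped n Y a b)
      (hD : IsDiamond D b c) (hac : a ≠ c) : IsUnclasped (n + 1) (Y ⊔ D) a c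
  | swap {n : ℕ} {U : SimpleGraph V} {a b : V} (hU : IsUnclasped n U a b) : IsUnclasped n U b a

/-- `L` is a (clasped) diamond lanyard of length `n`: an unclasped one together with an edge (the
clasp) between its endpoints. -/
def IsClasped {V : Type*} (n : ℕ) (L : SimpleGraph V) : Prop :=
  ∃ (U : SimpleGraph V) (a b : V), IsUnclasped n U a b ∧ L = U ⊔ SimpleGraph.edge a b

/-- `G` contains a (clasped) diamond lanyard, of some length, as a subgraph. -/
def ContainedIn {V : Type*} (G : SimpleGraph V) : Prop :=
  ∃ (n : ℕ) (L : SimpleGraph V), IsClasped n L ∧ L ≤ G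

end DiamondLanyard

/-! A 3-coloring gives the endpoints of a diamond equal colors, so the clasp of a lanyard rules out
3 colors (`ContainedIn.not_colorable`). In `X` the three generators sum to zero, so differences of
distinct generators join endpoints of diamonds. Modulo these differences all generators become one
element `g` with `3g = 0` and `(a + b)g = 0`; if 3 does not divide `a + b`, then `g = 0`, so a chain
of diamonds joins 0 to a neighbor (`containedIn`). If 3 divides `a + b`, the coordinate sum mod 3 is
a coloring. Four colors suffice greedily when a linear height vanishes on no generator
(`colorable_four_of_height`). Otherwise `X` is, up to symmetry, the triangular lattice modulo `(k,
0)`, colored explicitly (`colorable_axis`). -/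

namespace DiamondLanyard

/-! ### Diamond lanyards and 3-colorings -/

variable {V : Type*} {G U : SimpleGraph V} {n : ℕ} {a b : V}

theorem IsDiamond.ne (h : IsDiamond U a b) : a ≠ b := by
  obtain ⟨c, d, hab, -⟩ := h
  exact hab

theorem IsUnclasped.ne (h : IsUnclasped n U a b) : a ≠ b := by
  induction h with
  | diamond hD => exact hD.ne
  | union _ _ hac => exact hac
  | swap _ ih => exact ih.symm

theorem IsDiamond.coloring_eq (h : IsDiamond U a b) (hU : U ≤ G) (C : G.Coloring (Fin 3)) :
    C a = C b := by
  obtain ⟨c, d, hab, hac, had, hbc, hbd, hcd, rfl⟩ := h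
  have h1 : C a ≠ C c := C.valid (hU (by simp [hac]))
  have h2 : C a ≠ C d := C.valid (hU (by simp [had]))
  have h3 : C b ≠ C c := C.valid (hU (by simp [hbc]))
  have h4 : C b ≠ C d := C.valid (hU (by simp [hbd]))
  have h5 : C c ≠ C d := C.valid (hU (by simp [hcd]))
  omega

theorem IsUnclasped.coloring_eq (h : IsUnclasped n U a b) (hU : U ≤ G)
    (C : G.Coloring (Fin 3)) : C a = C b := by
  induction h with
  | diamond hD => exact hD.coloring_eq hU C
  | union _ hD _ ih =>
    exact (ih (le_sup_left.trans hU)).trans (hD.coloring_eq (le_sup_right.trans hU) C)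
  | swap _ ih => exact (ih hU).symm

/-- A diamond lanyard forces a fourth color. -/
theorem ContainedIn.not_colorable (h : ContainedIn G) : ¬ G.Colorable 3 := by
  rintro ⟨C⟩
  obtain ⟨n, L, ⟨U, a, b, hU, rfl⟩, hL⟩ := h
  refine C.valid (hL (Or.inr ?_)) (hU.coloring_eq (le_sup_left.trans hL) C)
  simp [SimpleGraph.edge_adj, hU.ne]

/-- Lanyards can be built along a subgroup whose generators are differences of diamond
endpoints. -/
theorem exists_isUnclasped_of_mem_closure {A : Type*} [AddGroup A] {G : SimpleGraph A} {S : Set A}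
    (hS : ∀ x, ∀ s ∈ S, ∃ D ≤ G, IsDiamond D x (x + s))
    (hS' : ∀ x, ∀ s ∈ S, ∃ D ≤ G, IsDiamond D x (x + -s))
    {w : A} (hw : w ∈ AddSubgroup.closure S) :
    w = 0 ∨ ∃ n, ∃ U ≤ G, IsUnclasped n U 0 w := by
  -- A lanyard needs distinct endpoints, so a chain that returns to 0 is discarded and restarted
  -- there.
  have step : ∀ x y : A, (x = 0 ∨ ∃ n, ∃ U ≤ G, IsUnclasped n U 0 x) →
      (∃ D ≤ G, IsDiamond D x y) → y = 0 ∨ ∃ n, ∃ U ≤ G, IsUnclasped n U 0 y := by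
    rintro x y (rfl | ⟨n, U, hU, hUx⟩) ⟨D, hD, hDxy⟩
    · exact Or.inr ⟨1, D, hD, .diamond hDxy⟩
    · refine or_iff_not_imp_left.2 fun hy => ⟨n + 1, U ⊔ D, sup_le hU hD, .union hUx hDxy ?_⟩
      exact Ne.symm hy
  induction hw using AddSubgroup.closure_induction_right with
  | zero => exact Or.inl rfl
  | add_right x _ s hs ih => exact step _ _ ih (hS x s hs)
  | add_neg_cancel x _ s hs ih => exact step _ _ ih (hS' x s hs)

end DiamondLanyard

/-! ### Greedy coloring by height -/

/-- If for some integer height function every vertex has at most `k` neighbors that are not higher,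
then the graph is `(k + 1)`-colorable. -/
theorem SimpleGraph.colorable_of_height {V : Type*} (G : SimpleGraph V) (k : ℕ) (f : V → ℤ)
    (N : V → Finset V) (hN : ∀ v, (N v).card ≤ k)
    (h : ∀ v w, G.Adj v w → f w ≤ f v → w ∈ N v) : G.Colorable (k + 1) := by
  classical
  have key : ∀ s : Finset V, ∃ c : V → Fin (k + 1), ∀ v ∈ s, ∀ w ∈ s, G.Adj v w → c v ≠ c w := by
    intro s
    induction s using Finset.induction_on_max_value f with
    | empty => exact ⟨fun _ => 0, by simp⟩
    | insert a s has hmax ih =>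
      obtain ⟨c, hc⟩ := ih
      obtain ⟨t, ht⟩ : ∃ t : Fin (k + 1), t ∉ (N a).image c := by
        by_contra! hall
        have h1 : (Finset.univ : Finset (Fin (k + 1))) ⊆ (N a).image c := fun t _ => hall t
        have h2 := Finset.card_le_card h1
        have h3 : ((N a).image c).card ≤ (N a).card := Finset.card_image_le
        have h4 := hN a
        simp only [Finset.card_univ, Fintype.card_fin] at h2
        omega
      have ht' : ∀ w ∈ s, G.Adj a w → t ≠ c w := fun w hw haw heq =>
        ht (heq ▸ Finset.mem_image_of_mem c (h a w haw (hmax w hw)))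
      refine ⟨Function.update c a t, ?_⟩
      intro v hv w hw hvw
      rcases Finset.mem_insert.1 hv with rfl | hvs
      · have hwv : w ≠ v := hvw.ne'
        have hws := Finset.mem_of_mem_insert_of_ne hw hwv
        simpa [hwv] using ht' w hws hvw
      · have hva : v ≠ a := fun h => has (h ▸ hvs)
        rcases Finset.mem_insert.1 hw with rfl | hws
        · simpa [hva] using (ht' v hvs hvw.symm).symm
        · have hwa : w ≠ a := fun h => has (h ▸ hws)
          simpa [hva, hwa] using hc v hvs w hws hvw
  choose c hc using key
  -- Compactness (de Bruijn–Erdős) passes from finite vertex sets to the whole graph.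
  refine SimpleGraph.nonempty_hom_of_forall_finite_subgraph_hom fun G' hG' => ?_
  refine ⟨fun v => c hG'.toFinset v, fun {v w} hvw => ?_⟩
  exact hc _ v (by simp) w (by simp) (G'.adj_sub hvw)

/-! ### Explicit 4-colorings of triangular lattice quotients -/

namespace TriangularLattice

/-- The quotient by `(a, b)` of the triangular lattice, on `ℤ × ℤ` with steps `±(1, 0)`, `±(0, 1)`,
`±(1, 1)`, is `4`-colorable. -/
def Colorable (a b : ℤ) : Prop :=
  ∃ c : ℤ → ℤ → Fin 4, (∀ x y, c (x + a) (y + b) = c x y) ∧ (∀ x y, c (x + 1) y ≠ c x y) ∧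
    (∀ x y, c x (y + 1) ≠ c x y) ∧ ∀ x y, c (x + 1) (y + 1) ≠ c x y

theorem Colorable.swap {a b : ℤ} (h : Colorable a b) : Colorable b a := by
  obtain ⟨c, h0, h1, h2, h3⟩ := h
  exact ⟨fun x y => c y x, fun x y => h0 y x, fun x y => h2 y x, fun x y => h1 y x,
    fun x y => h3 y x⟩

/-- The map `(x, y) ↦ (x, x - y)` permutes the six lattice steps and takes `(k, k)` to `(k, 0)`. -/
theorem Colorable.shear {k : ℤ} (h : Colorable k 0) : Colorable k k := by
  obtain ⟨c, h0, h1, h2, h3⟩ := h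
  refine ⟨fun x y => c x (x - y), fun x y => ?_, fun x y => ?_, fun x y => ?_, fun x y => ?_⟩
  · have := h0 x (x - y)
    rwa [add_zero, show c (x + k) (x - y) = c (x + k) (x + k - (y + k)) by congr 1; ring] at this
  · have := h3 x (x - y)
    rwa [show x - y + 1 = x + 1 - y by ring] at this
  · have := h2 x (x - (y + 1))
    rw [show x - (y + 1) + 1 = x - y by ring] at this
    exact this.symm
  · have := h1 x (x - y)
    rwa [show c (x + 1) (x - y) = c (x + 1) (x + 1 - (y + 1)) by congr 1; ring] at this

theorem Colorable.neg {k : ℤ} (h : Colorable (-k) 0) : Colorable k 0 := by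
  obtain ⟨c, h0, h⟩ := h
  refine ⟨c, fun x y => ?_, h⟩
  have := h0 (x + k) y
  simpa using this.symm

theorem colorable_two : Colorable 2 0 := by
  let T : Fin 2 → Fin 2 → Fin 4 := ![![0, 1], ![2, 3]]
  have hT : ∀ x y : Fin 2, T (x + 1) y ≠ T x y ∧ T x (y + 1) ≠ T x y ∧
      T (x + 1) (y + 1) ≠ T x y := by decide
  let T' : ZMod 2 → ZMod 2 → Fin 4 := T
  have key : ∀ x y : ZMod 2, T' (x + 1) y ≠ T' x y ∧ T' x (y + 1) ≠ T' x y ∧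
      T' (x + 1) (y + 1) ≠ T' x y := hT
  refine ⟨fun x y => T' x y, fun x y => ?_, fun x y => ?_, fun x y => ?_, fun x y => ?_⟩
  · have h2 : (2 : ZMod 2) = 0 := rfl
    simp [h2]
  · simpa using (key x y).1
  · simpa using (key x y).2.1
  · simpa using (key x y).2.2

/-- Coloring by `x + y` alone fails here: the square of a 5-cycle is complete. The table therefore
also depends on `y` mod 3. -/
theorem colorable_five : Colorable 5 0 := by
  let T : Fin 5 → Fin 3 → Fin 4 :=
    ![![0, 1, 3], ![1, 3, 2], ![0, 2, 1], ![2, 1, 0], ![3, 0, 2]]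
  have hT : ∀ (x : Fin 5) (y : Fin 3), T (x + 1) y ≠ T x y ∧ T x (y + 1) ≠ T x y ∧
      T (x + 1) (y + 1) ≠ T x y := by decide
  let T' : ZMod 5 → ZMod 3 → Fin 4 := T
  have key : ∀ (x : ZMod 5) (y : ZMod 3), T' (x + 1) y ≠ T' x y ∧ T' x (y + 1) ≠ T' x y ∧
      T' (x + 1) (y + 1) ≠ T' x y := hT
  refine ⟨fun x y => T' x y, fun x y => ?_, fun x y => ?_, fun x y => ?_, fun x y => ?_⟩
  · have h5 : (5 : ZMod 5) = 0 := rfl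
    simp [h5]
  · simpa using (key x y).1
  · simpa using (key x y).2.1
  · simpa using (key x y).2.2

/-- A coloring of the square of a `k`-cycle gives one of the lattice modulo `(k, 0)`. -/
theorem colorable_of_cycle {k : ℤ} (hk : 3 ≤ k) (p : ℤ → ℤ)
    (hp : ∀ r, 0 ≤ r → r < k → 0 ≤ p r ∧ p r < 4)
    (h1 : ∀ r, 0 ≤ r → r + 1 < k → p (r + 1) ≠ p r)
    (h2 : ∀ r, 0 ≤ r → r + 2 < k → p (r + 2) ≠ p r)
    (h3 : p 0 ≠ p (k - 1)) (h4 : p 0 ≠ p (k - 2)) (h5 : p 1 ≠ p (k - 1)) : Colorable k 0 := by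
  have hlt : ∀ n : ℤ, (p (n % k)).toNat < 4 := fun n => by
    have := hp (n % k) (Int.emod_nonneg _ (by omega)) (Int.emod_lt_of_pos _ (by omega))
    omega
  have hne : ∀ m n : ℤ, p (m % k) ≠ p (n % k) →
      (⟨_, hlt m⟩ : Fin 4) ≠ ⟨_, hlt n⟩ := fun m n hmn h => by
    have h' := Fin.mk.inj_iff.1 h
    have hm := hp (m % k) (Int.emod_nonneg _ (by omega)) (Int.emod_lt_of_pos _ (by omega))
    have hn := hp (n % k) (Int.emod_nonneg _ (by omega)) (Int.emod_lt_of_pos _ (by omega))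
    omega
  have hadd : ∀ n j : ℤ, 0 ≤ j → j < k →
      (n + j) % k = if n % k + j < k then n % k + j else n % k + j - k := fun n j hj hjk => by
    have hn0 := Int.emod_nonneg n (show k ≠ 0 by omega)
    have hn1 := Int.emod_lt_of_pos n (show 0 < k by omega)
    rw [Int.add_emod, Int.emod_eq_of_lt hj hjk]
    split_ifs with h
    · exact Int.emod_eq_of_lt (by omega) h
    · rw [← Int.sub_emod_right]
      exact Int.emod_eq_of_lt (by omega) (by omega)
  have step1 : ∀ n : ℤ, p ((n + 1) % k) ≠ p (n % k) := fun n => by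
    have hn0 := Int.emod_nonneg n (show k ≠ 0 by omega)
    have hn1 := Int.emod_lt_of_pos n (show 0 < k by omega)
    rw [hadd n 1 (by omega) (by omega)]
    split_ifs with h
    · exact h1 _ hn0 h
    · rwa [show n % k + 1 - k = 0 by omega, show n % k = k - 1 by omega]
  have step2 : ∀ n : ℤ, p ((n + 2) % k) ≠ p (n % k) := fun n => by
    have hn0 := Int.emod_nonneg n (show k ≠ 0 by omega)
    have hn1 := Int.emod_lt_of_pos n (show 0 < k by omega)
    rw [hadd n 2 (by omega) (by omega)]
    split_ifs with h
    · exact h2 _ hn0 h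
    · obtain h' | h' : n % k = k - 2 ∨ n % k = k - 1 := by omega
      · rwa [h', show k - 2 + 2 - k = 0 by ring]
      · rwa [h', show k - 1 + 2 - k = 1 by ring]
  refine ⟨fun x y => ⟨_, hlt (x + y)⟩, fun x y => ?_, fun x y => ?_, fun x y => ?_, fun x y => ?_⟩
  · simp only [show x + k + (y + 0) = x + y + k by ring, Int.add_emod_right]
  · apply hne
    rw [show x + 1 + y = x + y + 1 by ring]
    exact step1 _
  · apply hne
    rw [show x + (y + 1) = x + y + 1 by ring]
    exact step1 _
  · apply hne
    rw [show x + 1 + (y + 1) = x + y + 2 by ring]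
    exact step2 _

theorem colorable_of_pos {k : ℤ} (h0 : 1 < k) (h3 : ¬ 3 ∣ k) : Colorable k 0 := by
  obtain h | h : k % 3 = 1 ∨ k % 3 = 2 := by omega
  -- Blocks 012, with one final 3.
  · refine colorable_of_cycle (by omega) (fun r => if r = k - 1 then 3 else r % 3) ?_ ?_ ?_ ?_ ?_ ?_
    all_goals intros; grind
  · obtain rfl | rfl | h8 : k = 2 ∨ k = 5 ∨ 8 ≤ k := by omega
    · exact colorable_two
    · exact colorable_five
    -- Since `k - 8` is divisible by 3, blocks 012 can be followed by two blocks 0123.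
    · refine colorable_of_cycle (by omega)
        (fun r => if r < k - 8 then r % 3 else (r - (k - 8)) % 4) ?_ ?_ ?_ ?_ ?_ ?_
      all_goals intros; grind

theorem colorable_axis {k : ℤ} (h1 : k ≠ 1) (h1' : k ≠ -1) (h3 : ¬ 3 ∣ k) : Colorable k 0 := by
  obtain h | h | rfl : 1 < k ∨ 1 < -k ∨ k = 0 := by omega
  · exact colorable_of_pos h h3
  · exact (colorable_of_pos h (by omega)).neg
  · simp at h3

end TriangularLattice

/-! ### General Cayley graphs: loops, adjacency, colorings -/

namespace SACG

open DiamondLanyard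

section General

variable {m r : ℕ} (M : Matrix (Fin m) (Fin r) ℤ)

theorem gen_eq_zero_iff (j : Fin m) : gen M j = 0 ↔ Pi.single j 1 ∈ relations M := by
  rw [gen, Submodule.mkQ_apply, Submodule.Quotient.mk_eq_zero]

theorem hasLoops_iff : HasLoops M ↔ ∃ j, gen M j = 0 := by
  simp only [HasLoops, graph, sub_self, generators, Set.mem_ofPred_eq, exists_const]
  refine exists_congr fun j => ?_
  rw [eq_comm, zero_eq_neg, or_self]

variable {M}

theorem adj_iff (h : ¬ HasLoops M) (x y : Vertex M) :
    (simpleGraph M).Adj x y ↔ ∃ j, y = x + gen M j ∨ y = x - gen M j := by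
  rw [simpleGraph_adj_iff M h]
  refine exists_congr fun j => ?_
  rw [sub_eq_iff_eq_add', sub_eq_iff_eq_add', ← sub_eq_add_neg]

theorem adj_add_gen (h : ¬ HasLoops M) (x : Vertex M) (j : Fin m) :
    (simpleGraph M).Adj x (x + gen M j) :=
  (adj_iff h _ _).2 ⟨j, Or.inl rfl⟩

theorem adj_sub_gen (h : ¬ HasLoops M) (x : Vertex M) (j : Fin m) :
    (simpleGraph M).Adj x (x - gen M j) :=
  (adj_iff h _ _).2 ⟨j, Or.inr rfl⟩

/-- To color a loopless standardized abelian Cayley graph, color `ℤ^m` periodically. -/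
theorem colorable_of_periodic (h : ¬ HasLoops M) {n : ℕ} (F : (Fin m → ℤ) → Fin n)
    (hF : ∀ v, ∀ w ∈ relations M, F (v + w) = F v)
    (hne : ∀ v j, F (v + Pi.single j 1) ≠ F v) : (simpleGraph M).Colorable n := by
  have hquot : ∀ v w, (relations M).mkQ v = (relations M).mkQ w → F v = F w := by
    intro v w hvw
    have := (Submodule.Quotient.eq (relations M)).1 hvw
    rw [← hF w _ this, add_sub_cancel]
  let s := Function.surjInv (relations M).mkQ_surjective
  have hs : ∀ x, (relations M).mkQ (s x) = x := Function.surjInv_eq _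
  have hadd : ∀ x j, F (s (x + gen M j)) ≠ F (s x) := by
    intro x j
    rw [hquot (s (x + gen M j)) (s x + Pi.single j 1) (by rw [hs, map_add, hs]; rfl)]
    exact hne _ _
  refine ⟨SimpleGraph.Coloring.mk (fun x => F (s x)) fun {x y} hxy => ?_⟩
  obtain ⟨j, rfl | rfl⟩ := (adj_iff h x y).1 hxy
  · exact (hadd x j).symm
  · simpa using hadd (x - gen M j) j

/-- Of `x + g` and `x - g` exactly one is lower than `x`, so each generator contributes one lower
neighbor. -/
theorem colorable_of_linear (h : ¬ HasLoops M) (f : Vertex M →ₗ[ℤ] ℤ)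
    (hf : ∀ j, f (gen M j) ≠ 0) : (simpleGraph M).Colorable (m + 1) := by
  classical
  refine SimpleGraph.colorable_of_height _ m f
    (fun v => Finset.univ.image fun j =>
      if 0 < f (gen M j) then v - gen M j else v + gen M j) ?_ ?_
  · intro v
    exact Finset.card_image_le.trans (by simp)
  · intro v w hvw hle
    obtain ⟨j, hj⟩ := (adj_iff h v w).1 hvw
    refine Finset.mem_image.2 ⟨j, Finset.mem_univ _, ?_⟩
    have hfj := hf j
    rcases hj with rfl | rfl
    · rw [map_add] at hle
      rw [if_neg (by omega)]
    · rw [map_sub] at hle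
      rw [if_pos (by omega)]

end General

/-! ### The graph of the given matrix -/

section Triangular

variable {a b : ℤ}

theorem mem_relations (v : Fin 3 → ℤ) :
    v ∈ relations !![1, 0; 1, a; 1, b] ↔ ∃ s t, s = v 0 ∧ s + t * a = v 1 ∧ s + t * b = v 2 := by
  rw [relations, Submodule.mem_span_range_iff_exists_fun]
  constructor
  · rintro ⟨c, rfl⟩
    refine ⟨c 0, c 1, ?_⟩
    simp [Fin.sum_univ_two, Matrix.col]
  · rintro ⟨s, t, h0, h1, h2⟩
    refine ⟨![s, t], ?_⟩
    ext i
    fin_cases i <;> simp [Fin.sum_univ_two, Matrix.col, ← h0, ← h1, ← h2]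

theorem gen_zero_eq_zero_iff : gen !![1, 0; 1, a; 1, b] 0 = 0 ↔ a = b ∧ (a = 1 ∨ a = -1) := by
  rw [gen_eq_zero_iff, mem_relations]
  simp only [Pi.single_apply, Fin.isValue]
  constructor
  · rintro ⟨s, t, h0, h1, h2⟩
    simp at h0 h1 h2
    subst h0
    have ha : -t * a = 1 := by linarith
    have hb : -t * b = 1 := by linarith
    rcases Int.eq_one_or_neg_one_of_mul_eq_one' ha with ⟨h, rfl⟩ | ⟨h, rfl⟩ <;>
      rw [h] at hb <;> omega
  · rintro ⟨rfl, rfl | rfl⟩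
    · exact ⟨1, -1, by simp⟩
    · exact ⟨1, 1, by simp⟩

theorem gen_one_eq_zero_iff : gen !![1, 0; 1, a; 1, b] 1 = 0 ↔ b = 0 ∧ (a = 1 ∨ a = -1) := by
  rw [gen_eq_zero_iff, mem_relations]
  simp only [Pi.single_apply, Fin.isValue]
  constructor
  · rintro ⟨s, t, h0, h1, h2⟩
    simp at h0 h1 h2
    subst h0
    have ha : t * a = 1 := by linarith
    have hb : t * b = 0 := by linarith
    rcases Int.eq_one_or_neg_one_of_mul_eq_one' ha with ⟨h, rfl⟩ | ⟨h, rfl⟩ <;>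
      rw [h] at hb <;> omega
  · rintro ⟨rfl, rfl | rfl⟩
    · exact ⟨0, 1, by simp⟩
    · exact ⟨0, -1, by simp⟩

theorem gen_two_eq_zero_iff : gen !![1, 0; 1, a; 1, b] 2 = 0 ↔ a = 0 ∧ (b = 1 ∨ b = -1) := by
  rw [gen_eq_zero_iff, mem_relations]
  simp only [Pi.single_apply, Fin.isValue]
  constructor
  · rintro ⟨s, t, h0, h1, h2⟩
    simp at h0 h1 h2
    subst h0
    have ha : t * b = 1 := by linarith
    have hb : t * a = 0 := by linarith
    rcases Int.eq_one_or_neg_one_of_mul_eq_one' ha with ⟨h, rfl⟩ | ⟨h, rfl⟩ <;>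
      rw [h] at hb <;> omega
  · rintro ⟨rfl, rfl | rfl⟩
    · exact ⟨0, 1, by simp⟩
    · exact ⟨0, -1, by simp⟩

theorem hasLoops_triangular_iff : HasLoops !![1, 0; 1, a; 1, b] ↔
    (a = b ∧ (a = 1 ∨ a = -1)) ∨ (b = 0 ∧ (a = 1 ∨ a = -1)) ∨ (a = 0 ∧ (b = 1 ∨ b = -1)) := by
  rw [hasLoops_iff, Fin.exists_fin_succ, Fin.exists_fin_two]
  exact or_congr gen_zero_eq_zero_iff (or_congr gen_one_eq_zero_iff gen_two_eq_zero_iff)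

theorem gen_sum : gen !![1, 0; 1, a; 1, b] 0 + gen !![1, 0; 1, a; 1, b] 1 +
    gen !![1, 0; 1, a; 1, b] 2 = 0 := by
  simp only [gen, ← map_add]
  rw [Submodule.mkQ_apply, Submodule.Quotient.mk_eq_zero, mem_relations]
  exact ⟨1, 0, by simp⟩

theorem zsmul_gen_add_zsmul_gen : a • gen !![1, 0; 1, a; 1, b] 1 +
    b • gen !![1, 0; 1, a; 1, b] 2 = 0 := by
  simp only [gen, ← map_add, ← map_zsmul]
  rw [Submodule.mkQ_apply, Submodule.Quotient.mk_eq_zero, mem_relations]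
  exact ⟨0, 1, by simp⟩

/-- Two distinct generators sum to the negative of the third. -/
theorem exists_gen_add_gen {i j : Fin 3} (hij : i ≠ j) : ∃ k,
    gen !![1, 0; 1, a; 1, b] i + gen !![1, 0; 1, a; 1, b] j = -gen !![1, 0; 1, a; 1, b] k := by
  have h := gen_sum (a := a) (b := b)
  have key : ∃ k, k ≠ i ∧ k ≠ j := by revert i j; decide
  obtain ⟨k, hki, hkj⟩ := key
  refine ⟨k, ?_⟩
  rw [eq_neg_iff_add_eq_zero, ← h]
  fin_cases i <;> fin_cases j <;> fin_cases k <;> simp at hij hki hkj ⊢ <;> abel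

/-- If `e_i - e_j` is a relation, its zero coordinate sum gives `3s + t(a + b) = 0`, so 3 divides
`t` and all coordinates agree mod 3; but they are 1, -1, 0. -/
theorem gen_ne_gen (hab : ¬ 3 ∣ a + b) {i j : Fin 3} (hij : i ≠ j) :
    gen !![1, 0; 1, a; 1, b] i ≠ gen !![1, 0; 1, a; 1, b] j := by
  intro h
  have h' := (Submodule.Quotient.eq (relations !![1, 0; 1, a; 1, b])).1 h
  obtain ⟨s, t, h0, h1, h2⟩ := (mem_relations _).1 h'
  have hs : (Pi.single i 1 - Pi.single j 1 : Fin 3 → ℤ) 0 +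
      (Pi.single i 1 - Pi.single j 1 : Fin 3 → ℤ) 1 +
      (Pi.single i 1 - Pi.single j 1 : Fin 3 → ℤ) 2 = 0 := by
    fin_cases i <;> fin_cases j <;> simp at hij ⊢
  have hdvd : (3 : ℤ) ∣ t * (a + b) := ⟨-s, by linarith⟩
  obtain ⟨u, rfl⟩ := (Int.prime_three.dvd_or_dvd hdvd).resolve_right hab
  have e0 : s % 3 = (Pi.single i 1 - Pi.single j 1 : Fin 3 → ℤ) 0 % 3 := by rw [h0]
  have e1 : s % 3 = (Pi.single i 1 - Pi.single j 1 : Fin 3 → ℤ) 1 % 3 := by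
    rw [← h1, mul_assoc, Int.add_mul_emod_self_left]
  have e2 : s % 3 = (Pi.single i 1 - Pi.single j 1 : Fin 3 → ℤ) 2 % 3 := by
    rw [← h2, mul_assoc, Int.add_mul_emod_self_left]
  fin_cases i <;> fin_cases j <;> simp at hij e0 e1 e2 <;> omega

theorem exists_isDiamond (h : ¬ HasLoops !![1, 0; 1, a; 1, b]) (hab : ¬ 3 ∣ a + b)
    {i j : Fin 3} (hij : i ≠ j) :
    ∀ x, ∃ D ≤ simpleGraph !![1, 0; 1, a; 1, b], IsDiamond D x
      (x + (gen !![1, 0; 1, a; 1, b] i - gen !![1, 0; 1, a; 1, b] j)) := by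
  obtain ⟨k, hk⟩ := exists_gen_add_gen (a := a) (b := b) hij
  have hne := gen_ne_gen hab hij
  set M : Matrix (Fin 3) (Fin 2) ℤ := !![1, 0; 1, a; 1, b]
  intro x
  have h1 := adj_add_gen h x i
  have h2 := adj_sub_gen h x j
  have h3 := (adj_sub_gen h (x + (gen M i - gen M j)) i)
  rw [show x + (gen M i - gen M j) - gen M i = x - gen M j by abel] at h3
  have h4 := (adj_add_gen h (x + (gen M i - gen M j)) j)
  rw [show x + (gen M i - gen M j) + gen M j = x + gen M i by abel] at h4
  -- The middle edge of the diamond comes from the third generator.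
  have h5 := (adj_add_gen h (x + gen M i) k)
  rw [show x + gen M i + gen M k = x - gen M j by
    rw [← neg_neg (gen M k), ← hk]; abel] at h5
  refine ⟨_, ?_, x + gen M i, x - gen M j, ?_, h1.ne, h2.ne, h4.ne, h3.ne, h5.ne, rfl⟩
  · intro v w hvw
    rw [SimpleGraph.fromEdgeSet_adj] at hvw
    have hvw := hvw.1
    simp only [Set.mem_insert_iff, Set.mem_singleton_iff, Sym2.eq_iff] at hvw
    rcases hvw with (⟨rfl, rfl⟩ | ⟨rfl, rfl⟩) | (⟨rfl, rfl⟩ | ⟨rfl, rfl⟩) |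
      (⟨rfl, rfl⟩ | ⟨rfl, rfl⟩) | (⟨rfl, rfl⟩ | ⟨rfl, rfl⟩) | (⟨rfl, rfl⟩ | ⟨rfl, rfl⟩)
    exacts [h1, h1.symm, h2, h2.symm, h4, h4.symm, h3, h3.symm, h5, h5.symm]
  · intro hx
    rw [left_eq_add, sub_eq_zero] at hx
    exact hne hx

theorem containedIn (h : ¬ HasLoops !![1, 0; 1, a; 1, b]) (hab : ¬ 3 ∣ a + b) :
    ContainedIn (simpleGraph !![1, 0; 1, a; 1, b]) := by
  have hdiamond := fun i j => exists_isDiamond (i := i) (j := j) h hab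
  have hsum := gen_sum (a := a) (b := b)
  have hzero := zsmul_gen_add_zsmul_gen (a := a) (b := b)
  set M : Matrix (Fin 3) (Fin 2) ℤ := !![1, 0; 1, a; 1, b]
  have hgen : gen M 1 ≠ 0 := fun h1 => h ((hasLoops_iff M).2 ⟨1, h1⟩)
  let S : Set (Vertex M) := {s | ∃ i j, i ≠ j ∧ s = gen M i - gen M j}
  have hS : ∀ i j, i ≠ j → gen M i - gen M j ∈ AddSubgroup.closure S := fun i j hij =>
    AddSubgroup.subset_closure ⟨i, j, hij, rfl⟩
  have key : ∀ w ∈ AddSubgroup.closure S, (simpleGraph M).Adj 0 w → ContainedIn (simpleGraph M) := by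
    intro w hw hadj
    have hlanyard := exists_isUnclasped_of_mem_closure (G := simpleGraph M) (S := S) ?_ ?_ hw
    · obtain rfl | ⟨n, U, hU, hUw⟩ := hlanyard
      · exact absurd rfl hadj.ne
      · refine ⟨n, _, ⟨U, 0, w, hUw, rfl⟩, sup_le hU ?_⟩
        rw [SimpleGraph.edge_le_iff]
        exact Or.inr hadj
    · rintro x _ ⟨i, j, hij, rfl⟩
      exact hdiamond i j hij x
    · rintro x _ ⟨i, j, hij, rfl⟩
      rw [neg_sub]
      exact hdiamond j i hij.symm x
  have hmem : ∀ q : ℤ, (a + b - 3 * q) • gen M 1 ∈ AddSubgroup.closure S := by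
    intro q
    have h0 : gen M 0 = -(gen M 1 + gen M 2) := by
      rw [eq_neg_iff_add_eq_zero, ← hsum]; abel
    have : (a + b - 3 * q) • gen M 1 = -b • (gen M 2 - gen M 1) +
        -q • ((gen M 1 - gen M 0) + (gen M 1 - gen M 2)) := by
      rw [← sub_eq_zero, ← hzero, h0]
      module
    rw [this]
    exact add_mem (zsmul_mem (hS _ _ (by decide)) _)
      (zsmul_mem (add_mem (hS _ _ (by decide)) (hS _ _ (by decide))) _)
  obtain hr | hr : (a + b) % 3 = 1 ∨ (a + b) % 3 = 2 := by omega
  · refine key (gen M 1) ?_ (by simpa using adj_add_gen h 0 1)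
    have := hmem ((a + b) / 3)
    rwa [show a + b - 3 * ((a + b) / 3) = 1 by omega, one_zsmul] at this
  -- Rounding the quotient up leaves coefficient -1.
  · refine key (-gen M 1) ?_ (by simpa using adj_sub_gen h 0 1)
    have := hmem ((a + b) / 3 + 1)
    rwa [show a + b - 3 * ((a + b) / 3 + 1) = -1 by omega, neg_one_zsmul] at this

theorem not_colorable_two (h : ¬ HasLoops !![1, 0; 1, a; 1, b]) :
    ¬ (simpleGraph !![1, 0; 1, a; 1, b]).Colorable 2 := by
  rintro ⟨C⟩
  have hsum := gen_sum (a := a) (b := b)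
  set M : Matrix (Fin 3) (Fin 2) ℤ := !![1, 0; 1, a; 1, b]
  -- The three generators sum to zero and trace a triangle.
  have h1 := C.valid (adj_add_gen h 0 0)
  have h2 := C.valid (adj_add_gen h (0 + gen M 0) 1)
  have h3 := C.valid (adj_add_gen h (0 + gen M 0 + gen M 1) 2)
  rw [show 0 + gen M 0 + gen M 1 + gen M 2 = 0 by rw [zero_add, hsum]] at h3
  omega

theorem colorable_three (h : ¬ HasLoops !![1, 0; 1, a; 1, b]) (hab : 3 ∣ a + b) :
    (simpleGraph !![1, 0; 1, a; 1, b]).Colorable 3 := by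
  refine colorable_of_periodic h (fun v => ((v 0 + v 1 + v 2 : ℤ) : ZMod 3)) ?_ ?_
  · intro v w hw
    obtain ⟨s, t, h0, h1, h2⟩ := (mem_relations w).1 hw
    obtain ⟨u, hu⟩ := hab
    refine (ZMod.intCast_eq_intCast_iff_dvd_sub _ _ 3).2 ⟨-(s + t * u), ?_⟩
    simp only [Pi.add_apply, ← h0, ← h1, ← h2]
    push_cast
    linear_combination (-t) * hu
  · intro v j hv
    have := (ZMod.intCast_eq_intCast_iff_dvd_sub _ _ 3).1 hv
    fin_cases j <;> simp at this

theorem colorable_four_of_lattice (h : ¬ HasLoops !![1, 0; 1, a; 1, b])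
    (hc : TriangularLattice.Colorable a b) : (simpleGraph !![1, 0; 1, a; 1, b]).Colorable 4 := by
  obtain ⟨c, h0, h1, h2, h3⟩ := hc
  have hper : Function.Periodic (fun z : ℤ × ℤ => c z.1 z.2) (a, b) := fun z => h0 z.1 z.2
  -- This projection kills the column `(1, 1, 1)` and sends the other column to `(a, b)`.
  refine colorable_of_periodic h (fun v => c (v 1 - v 0) (v 2 - v 0)) ?_ ?_
  · intro v w hw
    obtain ⟨s, t, e0, e1, e2⟩ := (mem_relations w).1 hw
    have := hper.zsmul t (v 1 - v 0, v 2 - v 0)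
    simp only [Prod.smul_mk, Prod.mk_add_mk, smul_eq_mul] at this
    rw [← this]
    simp only [Pi.add_apply, ← e0, ← e1, ← e2]
    congr 1 <;> ring
  · intro v j
    fin_cases j
    · have := (h3 (v 1 - (v 0 + 1)) (v 2 - (v 0 + 1))).symm
      simp only [sub_add_eq_sub_sub, sub_add_cancel] at this
      simpa [Pi.single_apply, sub_add_eq_sub_sub] using this
    · simpa [Pi.single_apply, add_sub_right_comm] using h1 (v 1 - v 0) (v 2 - v 0)
    · simpa [Pi.single_apply, add_sub_right_comm] using h2 (v 1 - v 0) (v 2 - v 0)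

theorem colorable_four_of_height (h : ¬ HasLoops !![1, 0; 1, a; 1, b])
    (ha : a ≠ 0) (hb : b ≠ 0) (hab : a ≠ b) :
    (simpleGraph !![1, 0; 1, a; 1, b]).Colorable 4 := by
  -- Up to sign, the cross product of the two columns.
  let f₀ : (Fin 3 → ℤ) →ₗ[ℤ] ℤ :=
    (a - b) • LinearMap.proj 0 + b • LinearMap.proj 1 - a • LinearMap.proj 2
  let f : Vertex !![1, 0; 1, a; 1, b] →ₗ[ℤ] ℤ := (relations !![1, 0; 1, a; 1, b]).liftQ f₀ <| by
    intro v hv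
    obtain ⟨s, t, h0, h1, h2⟩ := (mem_relations v).1 hv
    simp only [f₀, LinearMap.mem_ker, LinearMap.sub_apply, LinearMap.add_apply,
      LinearMap.smul_apply, LinearMap.proj_apply, smul_eq_mul, ← h0, ← h1, ← h2]
    ring
  have hf : ∀ j, f (gen !![1, 0; 1, a; 1, b] j) ≠ 0 := by
    intro j
    have : f (gen !![1, 0; 1, a; 1, b] j) = f₀ (Pi.single j 1) := Submodule.liftQ_apply _ _ _
    rw [this]
    fin_cases j <;> simp [f₀, sub_eq_zero, ha, hb, hab]
  exact colorable_of_linear h f hf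

theorem colorable_four (h : ¬ HasLoops !![1, 0; 1, a; 1, b]) (hab : ¬ 3 ∣ a + b) :
    (simpleGraph !![1, 0; 1, a; 1, b]).Colorable 4 := by
  have hloops := mt hasLoops_triangular_iff.2 h
  by_cases hb : b = 0
  · subst hb
    exact colorable_four_of_lattice h
      (TriangularLattice.colorable_axis (by omega) (by omega) (by omega))
  by_cases ha : a = 0
  · subst ha
    exact colorable_four_of_lattice h
      (TriangularLattice.colorable_axis (by omega) (by omega) (by omega)).swap
  by_cases hne : a = b
  · subst hne
    exact colorable_four_of_lattice h
      (TriangularLattice.colorable_axis (by omega) (by omega) (by omega)).shear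
  exact colorable_four_of_height h ha hb hne

end Triangular

end SACG

theorem mainTheorem10 (y22 y32 : ℤ) :
    (SACG.HasLoops !![1, 0; 1, y22; 1, y32] ↔
      ({y22, y32} : Set ℤ) = {0, -1} ∨ ({y22, y32} : Set ℤ) = {0, 1} ∨
        ({y22, y32} : Set ℤ) = {-1} ∨ ({y22, y32} : Set ℤ) = {1}) ∧
    (¬ SACG.HasLoops !![1, 0; 1, y22; 1, y32] →
      (y32 ≡ -y22 [ZMOD 3] →
        (SACG.simpleGraph !![1, 0; 1, y22; 1, y32]).chromaticNumber = 3) ∧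
      (¬ y32 ≡ -y22 [ZMOD 3] →
        (SACG.simpleGraph !![1, 0; 1, y22; 1, y32]).chromaticNumber = 4 ∧
        DiamondLanyard.ContainedIn (SACG.simpleGraph !![1, 0; 1, y22; 1, y32]))) := by
  have hmod : y32 ≡ -y22 [ZMOD 3] ↔ 3 ∣ y22 + y32 := by
    rw [Int.modEq_iff_dvd]
    omega
  refine ⟨?_, fun h => ⟨fun hm => ?_, fun hm => ?_⟩⟩
  · have hsingle : ∀ z : ℤ, ({y22, y32} : Set ℤ) = {z} ↔ y22 = z ∧ y32 = z := fun z => by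
      rw [← Set.pair_eq_singleton z, Set.pair_eq_pair_iff, or_self]
    rw [SACG.hasLoops_triangular_iff, hsingle, hsingle, Set.pair_eq_pair_iff,
      Set.pair_eq_pair_iff]
    constructor <;> intro h <;> omega
  · exact SimpleGraph.chromaticNumber_eq_iff_colorable_not_colorable (n := 2).2
      ⟨SACG.colorable_three h (hmod.1 hm), SACG.not_colorable_two h⟩
  · have hc := SACG.containedIn h (mt hmod.2 hm)
    exact ⟨SimpleGraph.chromaticNumber_eq_iff_colorable_not_colorable (n := 3).2
      ⟨SACG.colorable_four h (mt hmod.2 hm), hc.not_colorable⟩, hc⟩
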